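/- Let $G$ be an arbitrary group, let $\mathbb{Z}G$ be its integral group ring with augmentation map $\varepsilon:\mathbb{Z}G\to\mathbb{Z}$, $\varepsilon(\sum_g n_g g)=\sum_g n_g$, and let $\Delta(G)=\ker\varepsilon$ be the augmentation ideal. Let $\mathcal{V}(\mathbb{Z}G)$ be the group of units of $\mathbb{Z}G$ of augmentation $1$, put $\mathcal{V}_n(\mathbb{Z}G)=\mathcal{V}(\mathbb{Z}G)\cap(1+\Delta(G)^n)$ for $n\ge 1$, and let $\mathcal{V}_\omega(\mathbb{Z}G)=\bigcap_{n\ge 1}\mathcal{V}_n(\mathbb{Z}G)$ be the $\Delta$-adic residue of $\mathcal{V}(\mathbb{Z}G)$. If $\mathcal{V}_\omega(\mathbb{Z}G)=\{1\}$, then $G$ has no element of order $pq$ with primes $p<q$, except possibly when $(p,q)=(2,3)$. In particular, if moreover $G$ has no element of order $2$ or $G$ has no element of order $3$, then every torsion element of $G$ has prime-power order (that is, order $p^k$ with $p$ a prime and $k\ge 0$). -/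

import Mathlib

namespace IntegralGroupRing

variable (G : Type*) [Group G]

/-- The augmentation map `ℤG → ℤ`, `∑ n_g g ↦ ∑ n_g`. -/
noncomputable def augmentation : MonoidAlgebra ℤ G →ₐ[ℤ] ℤ :=
  MonoidAlgebra.lift ℤ ℤ G (1 : G →* ℤ)

/-- The augmentation ideal `Δ(G)` of `ℤG`, the kernel of the augmentation map. -/
noncomputable def augmentationIdeal : Ideal (MonoidAlgebra ℤ G) :=
  RingHom.ker (augmentation G)

/-- The group `𝒱(ℤG)` of normalized units: the units of augmentation one in `ℤG`. -/
noncomputable def normalizedUnits : Subgroup (MonoidAlgebra ℤ G)ˣ where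
  carrier := {u | augmentation G (u : MonoidAlgebra ℤ G) = 1}
  one_mem' := by simp
  mul_mem' := by
    intro u v hu hv
    simp only [Set.mem_ofPred_eq] at hu hv ⊢
    rw [Units.val_mul, map_mul, hu, hv, one_mul]
  inv_mem' := by
    intro u hu
    simp only [Set.mem_ofPred_eq] at hu ⊢
    have h := congrArg (augmentation G) u.mul_inv
    rwa [map_mul, hu, one_mul, map_one] at h

/-- `𝒱_n(ℤG) = 𝒱(ℤG) ∩ (1 + Δ^n(G))`. -/
noncomputable def normalizedUnitsFiltration (n : ℕ) : Subgroup (MonoidAlgebra ℤ G)ˣ where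
  carrier := {u | u ∈ normalizedUnits G ∧
    (u : MonoidAlgebra ℤ G) - 1 ∈ augmentationIdeal G ^ n}
  one_mem' := ⟨one_mem _, by simp⟩
  mul_mem' := by
    rintro u v ⟨hu, hu'⟩ ⟨hv, hv'⟩
    refine ⟨mul_mem hu hv, ?_⟩
    have h : ((u * v : (MonoidAlgebra ℤ G)ˣ) : MonoidAlgebra ℤ G) - 1
        = (u : MonoidAlgebra ℤ G) * ((v : MonoidAlgebra ℤ G) - 1) + (u - 1) := by
      rw [Units.val_mul, mul_sub, mul_one, sub_add_sub_cancel]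
    rw [h]
    exact add_mem (Ideal.mul_mem_left _ _ hv') hu'
  inv_mem' := by
    rintro u ⟨hu, hu'⟩
    refine ⟨inv_mem hu, ?_⟩
    have h : ((u⁻¹ : (MonoidAlgebra ℤ G)ˣ) : MonoidAlgebra ℤ G) - 1
        = -(((u⁻¹ : (MonoidAlgebra ℤ G)ˣ) : MonoidAlgebra ℤ G)
            * ((u : MonoidAlgebra ℤ G) - 1)) := by
      rw [mul_sub, mul_one, Units.inv_mul, neg_sub]
    rw [h]
    exact neg_mem (Ideal.mul_mem_left _ _ hu')

/-- The `Δ`-adic residue `𝒱_ω(ℤG) = ⋂_{n ≥ 1} 𝒱_n(ℤG)` of `𝒱(ℤG)`. -/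
noncomputable def deltaAdicResidue : Subgroup (MonoidAlgebra ℤ G)ˣ :=
  ⨅ n : ℕ, ⨅ _ : 1 ≤ n, normalizedUnitsFiltration G n

end IntegralGroupRing

/-!
Let `g ∈ G` have order `n > 6`, not a prime power, and write `X ^ n - 1 = f * Φ_n` in `ℤ[X]`. Since
`Φ_n(1) = 1`, the polynomial `X - 1` has an inverse `v` modulo `Φ_n`. This has two consequences.
First, `f(g) = f(g) * v(g) * (g - 1)`, so `f(g)` lies in every `Δ(G) ^ k`. Second, the ring
`ℤ[X] / (f, Φ_n)` is finite, so some power `(X - 1) ^ m` with `m > 0` is congruent to `1 + w * f`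
modulo `Φ_n`; then `1 + w * f` is coprime to both `f` and `Φ_n`, so `1 + w(g) * f(g)` is a unit, and
it lies in the `Δ`-adic residue. It differs from `1`: otherwise `(ζ - 1) ^ m = 1` for
`ζ = exp(2πi / n)`, whereas `|ζ - 1| < 1` because `n > 6`.
-/

open Polynomial

namespace IntegralGroupRing

theorem isCoprime_X_sub_one_cyclotomic {n : ℕ} (hn : ∀ {p : ℕ}, p.Prime → ∀ k : ℕ, p ^ k ≠ n) :
    IsCoprime (X - 1 : ℤ[X]) (cyclotomic n ℤ) := by
  have hroot : (1 - cyclotomic n ℤ).IsRoot 1 := by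
    rw [IsRoot, eval_sub, eval_one, eval_one_cyclotomic_not_prime_pow hn, sub_self]
  obtain ⟨v, hv⟩ := dvd_iff_isRoot.mpr hroot
  rw [C_1] at hv
  exact ⟨v, 1, by linear_combination -hv⟩

-- Differentiate `f * h = X ^ n - 1` and multiply by `X`.
theorem natCast_mem_span_pair_of_mul_eq_X_pow_sub_one {R : Type*} [CommRing R] {f h : R[X]} {n : ℕ}
    (hfh : f * h = X ^ n - 1) : (n : R[X]) ∈ Ideal.span {f, h} := by
  rcases eq_or_ne n 0 with rfl | hn
  · simp
  have hderiv : derivative f * h + f * derivative h = (n : R[X]) * X ^ (n - 1) := by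
    rw [← derivative_mul, hfh, derivative_sub, derivative_one, sub_zero, derivative_X_pow,
      map_natCast]
  have hX : (X : R[X]) ^ (n - 1) * X = X ^ n := pow_sub_one_mul hn X
  refine Ideal.mem_span_pair.mpr ⟨derivative h * X - (n : R[X]) * h, derivative f * X, ?_⟩
  linear_combination X * hderiv + (n : R[X]) * hX - (n : R[X]) * hfh

theorem finite_quotient_of_monic_mem_of_natCast_mem {I : Ideal ℤ[X]} {P : ℤ[X]} (hP : P.Monic)
    (hPI : P ∈ I) {n : ℕ} (hn : n ≠ 0) (hnI : (n : ℤ[X]) ∈ I) : Finite (ℤ[X] ⧸ I) := by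
  have hle : Ideal.span {P} ≤ I := (Ideal.span_singleton_le_iff_mem I).mpr hPI
  have : Module.Finite ℤ (ℤ[X] ⧸ Ideal.span {P}) := hP.finite_quotient
  have : Module.Finite ℤ (ℤ[X] ⧸ I) :=
    .of_surjective (Ideal.Quotient.factorₐ ℤ hle).toLinearMap (Ideal.Quotient.factor_surjective hle)
  refine Module.finite_of_fg_torsion _ fun {x} ↦
    ⟨⟨n, mem_nonZeroDivisors_of_ne_zero (Nat.cast_ne_zero.mpr hn)⟩, ?_⟩
  have hn_zero : ((n : ℕ) : ℤ[X] ⧸ I) = 0 := by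
    rw [← map_natCast (Ideal.Quotient.mk I), Ideal.Quotient.eq_zero_iff_mem.mpr hnI]
  simp [Submonoid.smul_def, hn_zero]

theorem exists_pow_sub_one_mem_of_finite_quotient {R : Type*} [CommRing R] {I : Ideal R}
    [Finite (R ⧸ I)] {x : R} (hx : IsUnit (Ideal.Quotient.mk I x)) :
    ∃ m ≠ 0, x ^ m - 1 ∈ I := by
  obtain ⟨m, hm, hxm⟩ := hx.isOfFinOrder.exists_pow_eq_one
  exact ⟨m, hm.ne', Ideal.Quotient.eq.mp (by rw [map_pow, hxm, map_one])⟩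

theorem exists_pow_eq_one_add_mul_add_mul {f h p : ℤ[X]} {n : ℕ} (hn : n ≠ 0)
    (hfh : f * h = X ^ n - 1) (hp : IsCoprime p h) :
    ∃ m ≠ 0, ∃ w c : ℤ[X], p ^ m = 1 + w * f + h * c := by
  have hf : f ∈ Ideal.span {f, h} := Ideal.subset_span (by simp)
  have hh : h ∈ Ideal.span {f, h} := Ideal.subset_span (by simp)
  have : Finite (ℤ[X] ⧸ Ideal.span {f, h}) :=
    finite_quotient_of_monic_mem_of_natCast_mem (monic_X_pow_sub_C 1 hn)
      (by rw [C_1, ← hfh]; exact Ideal.mul_mem_right _ _ hf) hn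
      (natCast_mem_span_pair_of_mul_eq_X_pow_sub_one hfh)
  have hunit : IsUnit (Ideal.Quotient.mk (Ideal.span {f, h}) p) := by
    rw [← isCoprime_zero_right, ← Ideal.Quotient.eq_zero_iff_mem.mpr hh]
    exact hp.map _
  obtain ⟨m, hm, hpm⟩ := exists_pow_sub_one_mem_of_finite_quotient hunit
  obtain ⟨w, c, hwc⟩ := Ideal.mem_span_pair.mp hpm
  exact ⟨m, hm, w, c, by linear_combination -hwc⟩

theorem norm_exp_two_pi_mul_I_div_sub_one_lt_one {n : ℕ} (hn : 6 < n) :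
    ‖Complex.exp (2 * Real.pi * Complex.I / n) - 1‖ < 1 := by
  have hn' : (7 : ℝ) ≤ n := by exact_mod_cast hn
  have harg : (2 * Real.pi * Complex.I / n : ℂ) = Complex.I * (2 * Real.pi / n : ℝ) := by
    push_cast; ring
  calc ‖Complex.exp (2 * Real.pi * Complex.I / n) - 1‖
      ≤ ‖2 * Real.pi / n‖ := harg ▸ Real.norm_exp_I_mul_ofReal_sub_one_le
    _ = 2 * Real.pi / n := Real.norm_of_nonneg (by positivity)
    _ < 1 := by rw [div_lt_one (by linarith)]; linarith [Real.pi_lt_d2]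

theorem not_cyclotomic_dvd_X_sub_one_pow_sub_one {n : ℕ} (hn : 6 < n) {m : ℕ} (hm : m ≠ 0) :
    ¬ cyclotomic n ℤ ∣ (X - 1) ^ m - 1 := by
  intro hdvd
  set ζ : ℂ := Complex.exp (2 * Real.pi * Complex.I / n)
  have hζ : aeval ζ (cyclotomic n ℤ) = 0 := by
    have hroot := (Complex.isPrimitiveRoot_exp n (by lia)).isRoot_cyclotomic (by lia)
    rwa [IsRoot, ← map_cyclotomic_int, eval_map] at hroot
  have hpow : (ζ - 1) ^ m = 1 := by
    simpa [sub_eq_zero] using aeval_eq_zero_of_dvd_aeval_eq_zero hdvd hζ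
  have hlt : ‖ζ - 1‖ ^ m < 1 :=
    pow_lt_one₀ (norm_nonneg _) (norm_exp_two_pi_mul_I_div_sub_one_lt_one hn) hm
  rw [← norm_pow, hpow, norm_one] at hlt
  exact hlt.false

theorem isUnit_aeval_of_isCoprime {R A : Type*} [CommSemiring R] [Semiring A] [Algebra R A] {x : A}
    {p q : R[X]} (hp : aeval x p = 0) (hpq : IsCoprime p q) : IsUnit (aeval x q) := by
  obtain ⟨a, b, hab⟩ := hpq
  have hbq : aeval x (b * q) = 1 := by
    rw [← map_one (aeval (R := R) x), ← hab, map_add, map_mul _ a, hp, mul_zero, zero_add]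
  exact ⟨⟨aeval x q, aeval x b, by rw [← map_mul, mul_comm, hbq], by rw [← map_mul, hbq]⟩, rfl⟩

theorem linearIndependent_of_pow {R M : Type*} [Semiring R] [Monoid M] (g : M) :
    LinearIndependent R fun i : Fin (orderOf g) ↦ MonoidAlgebra.of R M g ^ (i : ℕ) := by
  have hinj : Function.Injective fun i : Fin (orderOf g) ↦ g ^ (i : ℕ) := fun i j hij ↦
    Fin.ext (pow_injOn_Iio_orderOf i.isLt j.isLt hij)
  convert (MonoidAlgebra.basis M R).linearIndependent.comp _ hinj using 2 with i
  simp [MonoidAlgebra.single_pow]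

section EvalAtGroupLike

variable {R M : Type*} [CommRing R] [Monoid M]

theorem aeval_of_X_pow_orderOf_sub_one (g : M) :
    aeval (MonoidAlgebra.of R M g) (X ^ orderOf g - 1 : R[X]) = 0 := by
  rw [map_sub, map_pow, aeval_X, map_one, ← map_pow, pow_orderOf_eq_one, map_one, sub_self]

theorem eq_zero_of_degree_lt_of_aeval_of_eq_zero {g : M} {p : R[X]} (hdeg : p.degree < orderOf g)
    (hp : aeval (MonoidAlgebra.of R M g) p = 0) : p = 0 := by
  rcases eq_or_ne p 0 with rfl | hp0
  · rfl
  have hsum : ∑ i : Fin (orderOf g), p.coeff i • MonoidAlgebra.of R M g ^ (i : ℕ) = 0 := by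
    rw [← hp, aeval_eq_sum_range' ((natDegree_lt_iff_degree_lt hp0).mpr hdeg),
      Finset.sum_range]
  ext i
  rcases lt_or_ge i (orderOf g) with hi | hi
  · exact Fintype.linearIndependent_iff.mp (linearIndependent_of_pow g) _ hsum ⟨i, hi⟩
  · exact coeff_eq_zero_of_degree_lt (hdeg.trans_le (by exact_mod_cast hi))

theorem X_pow_orderOf_sub_one_dvd_of_aeval_of_eq_zero {g : M} (hg : IsOfFinOrder g) {p : R[X]}
    (hp : aeval (MonoidAlgebra.of R M g) p = 0) : X ^ orderOf g - 1 ∣ p := by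
  nontriviality R
  have hmonic : (X ^ orderOf g - 1 : R[X]).Monic := monic_X_pow_sub_C 1 hg.orderOf_pos.ne'
  rw [← modByMonic_eq_zero_iff_dvd hmonic]
  refine eq_zero_of_degree_lt_of_aeval_of_eq_zero (g := g) ?_ ?_
  · exact (degree_modByMonic_lt p hmonic).trans_eq (degree_X_pow_sub_C hg.orderOf_pos 1)
  · exact (aeval_modByMonic_eq_self_of_root (aeval_of_X_pow_orderOf_sub_one g)).trans hp

end EvalAtGroupLike

theorem mem_ideal_pow_of_mul_eq_self {R : Type*} [Semiring R] {I : Ideal R} {a t : R} (ha : a ∈ I)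
    (hta : t * a = t) (k : ℕ) : t ∈ I ^ k := by
  have htk : t * a ^ k = t := by
    induction k with
    | zero => rw [pow_zero, mul_one]
    | succ k ih => rw [pow_succ, ← mul_assoc, ih, hta]
  exact htk ▸ Ideal.mul_mem_left _ _ (Ideal.pow_mem_pow ha k)

section Residue

variable {G : Type*} [Group G]

theorem of_sub_one_mem_augmentationIdeal (g : G) :
    MonoidAlgebra.of ℤ G g - 1 ∈ augmentationIdeal G := by
  simp [augmentationIdeal, augmentation, RingHom.mem_ker]

theorem mem_deltaAdicResidue_iff {u : (MonoidAlgebra ℤ G)ˣ} :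
    u ∈ deltaAdicResidue G ↔
      ∀ k, 1 ≤ k → (u : MonoidAlgebra ℤ G) - 1 ∈ augmentationIdeal G ^ k := by
  simp only [deltaAdicResidue, Subgroup.mem_iInf]
  refine ⟨fun hu k hk ↦ (hu k hk).2, fun hu k hk ↦ ⟨?_, hu k hk⟩⟩
  have hu1 := hu 1 le_rfl
  rwa [Submodule.pow_one, augmentationIdeal, RingHom.mem_ker, map_sub, map_one,
    sub_eq_zero] at hu1

theorem aeval_of_mem_augmentationIdeal_pow {g : G} {f h : ℤ[X]}
    (hfh : aeval (MonoidAlgebra.of ℤ G g) (f * h) = 0) (hh : IsCoprime (X - 1) h) (k : ℕ) :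
    aeval (MonoidAlgebra.of ℤ G g) f ∈ augmentationIdeal G ^ k := by
  obtain ⟨v, b, hvb⟩ := hh
  have hmem : aeval (MonoidAlgebra.of ℤ G g) (v * (X - 1)) ∈ augmentationIdeal G := by
    rw [map_mul, map_sub, aeval_X, map_one]
    exact Ideal.mul_mem_left _ _ (of_sub_one_mem_augmentationIdeal g)
  refine mem_ideal_pow_of_mul_eq_self hmem ?_ k
  rw [← map_mul, show f * (v * (X - 1)) = f - b * (f * h) by linear_combination f * hvb, map_sub,
    map_mul _ b, hfh, mul_zero, sub_zero]

theorem deltaAdicResidue_ne_bot {g : G} (h6 : 6 < orderOf g)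
    (hg : ∀ {p : ℕ}, p.Prime → ∀ k : ℕ, p ^ k ≠ orderOf g) : deltaAdicResidue G ≠ ⊥ := by
  have hn : orderOf g ≠ 0 := by lia
  have hΦ := isCoprime_X_sub_one_cyclotomic hg
  obtain ⟨f, hf⟩ := cyclotomic.dvd_X_pow_sub_one (orderOf g) ℤ
  rw [eq_comm, mul_comm] at hf
  have hroot := aeval_of_X_pow_orderOf_sub_one (R := ℤ) g
  obtain ⟨m, hm, w, c, hmwc⟩ := exists_pow_eq_one_add_mul_add_mul hn hf hΦ
  have hcop_f : IsCoprime f (1 + w * f) := isCoprime_one_right.add_mul_right_right w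
  have hcop_Φ : IsCoprime (cyclotomic (orderOf g) ℤ) (1 + w * f) :=
    .of_add_mul_left_right (hmwc ▸ hΦ.symm.pow_right)
  obtain ⟨u, hu⟩ := isUnit_aeval_of_isCoprime hroot (hf ▸ hcop_f.mul_left hcop_Φ)
  have hu_sub_one : (u : MonoidAlgebra ℤ G) - 1 = aeval (MonoidAlgebra.of ℤ G g) (w * f) := by
    rw [hu, map_add, map_one, add_sub_cancel_left]
  have hu_mem : u ∈ deltaAdicResidue G := mem_deltaAdicResidue_iff.mpr fun k _ ↦ by
    rw [hu_sub_one, map_mul]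
    exact Ideal.mul_mem_left _ _ (aeval_of_mem_augmentationIdeal_pow (by rw [hf, hroot]) hΦ k)
  have hu_ne_one : u ≠ 1 := by
    rintro rfl
    rw [Units.val_one, sub_self] at hu_sub_one
    have hdvd : cyclotomic (orderOf g) ℤ ∣ w * f := (Dvd.intro_left f hf).trans <|
      X_pow_orderOf_sub_one_dvd_of_aeval_of_eq_zero (orderOf_ne_zero_iff.mp hn) hu_sub_one.symm
    refine not_cyclotomic_dvd_X_sub_one_pow_sub_one h6 hm ?_
    rw [hmwc, add_assoc, add_sub_cancel_left]
    exact dvd_add hdvd (dvd_mul_right _ _)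
  exact fun hbot ↦ hu_ne_one ((Subgroup.eq_bot_iff_forall _).mp hbot u hu_mem)

end Residue

theorem eq_six_of_le_six_of_ne_prime_pow {n : ℕ} (h0 : 0 < n) (h6 : n ≤ 6)
    (hn : ∀ {p : ℕ}, p.Prime → ∀ k : ℕ, p ^ k ≠ n) : n = 6 := by
  have h1 := hn Nat.prime_two 0
  have h2 := hn Nat.prime_two 1
  have h3 := hn Nat.prime_three 1
  have h4 := hn Nat.prime_two 2
  have h5 := hn Nat.prime_five 1
  lia

theorem mul_ne_prime_pow {p q r : ℕ} (hp : p.Prime) (hq : q.Prime) (hpq : p ≠ q) (hr : r.Prime)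
    (k : ℕ) : p * q ≠ r ^ k := by
  intro h
  have hpr : p = r := (Nat.prime_dvd_prime_iff_eq hp hr).mp (hp.dvd_of_dvd_pow (Dvd.intro _ h))
  have hqr : q = r := (Nat.prime_dvd_prime_iff_eq hq hr).mp (hq.dvd_of_dvd_pow (Dvd.intro_left _ h))
  exact hpq (hpr.trans hqr.symm)

theorem eq_two_three_of_mul_eq_six {p q : ℕ} (hp : 1 < p) (hpq : p < q) (h : p * q = 6) :
    (p, q) = (2, 3) := by
  obtain rfl : p = 2 := by nlinarith
  obtain rfl : q = 3 := by lia
  rfl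

theorem orderOf_ne_six {M : Type*} [Monoid M]
    (hM : (∀ g : M, g ^ 2 = 1 → g = 1) ∨ (∀ g : M, g ^ 3 = 1 → g = 1)) (g : M) :
    orderOf g ≠ 6 := by
  intro hg
  have hg6 : g ^ 6 = 1 := hg ▸ pow_orderOf_eq_one g
  rcases hM with h2 | h3
  · exact pow_ne_one_of_lt_orderOf (by norm_num) (by lia) (h2 (g ^ 3) (by rw [← pow_mul, hg6]))
  · exact pow_ne_one_of_lt_orderOf (by norm_num) (by lia) (h3 (g ^ 2) (by rw [← pow_mul, hg6]))

end IntegralGroupRing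

open IntegralGroupRing

theorem mainTheorem3_general {G : Type*} [Group G] (hG : deltaAdicResidue G = ⊥) {g : G}
    (hg : IsOfFinOrder g) : (∃ p k : ℕ, p.Prime ∧ orderOf g = p ^ k) ∨ orderOf g = 6 := by
  refine or_iff_not_imp_left.mpr fun hne ↦ ?_
  have hpp : ∀ {p : ℕ}, p.Prime → ∀ k : ℕ, p ^ k ≠ orderOf g :=
    fun hp k hk ↦ hne ⟨_, k, hp, hk.symm⟩
  have hle : orderOf g ≤ 6 := not_lt.mp fun h6 ↦ deltaAdicResidue_ne_bot h6 hpp hG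
  exact eq_six_of_le_six_of_ne_prime_pow hg.orderOf_pos hle hpp

theorem mainTheorem3 {G : Type*} [Group G]
    (hG : IntegralGroupRing.deltaAdicResidue G = ⊥) :
    (∀ p q : ℕ, p.Prime → q.Prime → p < q → (p, q) ≠ (2, 3) →
      ¬ ∃ g : G, orderOf g = p * q) ∧
    (((∀ g : G, g ^ 2 = 1 → g = 1) ∨ (∀ g : G, g ^ 3 = 1 → g = 1)) →
      ∀ g : G, IsOfFinOrder g → ∃ p k : ℕ, p.Prime ∧ orderOf g = p ^ k) := by
  refine ⟨?_, fun htorsion g hg ↦ (mainTheorem3_general hG hg).resolve_right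
    (orderOf_ne_six htorsion g)⟩
  rintro p q hp hq hpq hne ⟨g, hg⟩
  have hfin : IsOfFinOrder g := orderOf_ne_zero_iff.mp (hg ▸ mul_ne_zero hp.ne_zero hq.ne_zero)
  rcases mainTheorem3_general hG hfin with ⟨r, k, hr, hk⟩ | h6
  · exact mul_ne_prime_pow hp hq hpq.ne hr k (hg ▸ hk)
  · exact hne (eq_two_three_of_mul_eq_six hp.one_lt hpq (hg ▸ h6))
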